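/- Let $\xi_1,\xi_2,\dots$ be independent identically distributed real random variables with distribution function $F$, and write $\overline F(x)=1-F(x)$ and $\hat F(\gamma)=\int_{\mathbb R} e^{\gamma y}\,dF(y)\in(0,\infty]$. Suppose that, for some $\gamma>0$, $F$ belongs to the class $\mathcal S(\gamma)$, i.e. $\overline F(x)>0$ for all $x$; $\lim_{x\to\infty}\overline F(x-k)/\overline F(x)=e^{\gamma k}$ for every fixed $k\in\mathbb R$; $\hat F(\gamma)<\infty$; and $\overline{F*F}(x)\sim 2\hat F(\gamma)\overline F(x)$ as $x\to\infty$. Suppose moreover that $\hat F(\gamma)<1$. Let $S_0=0$, $S_n=\xi_1+\dots+\xi_n$, $M_n=\max_{0\le i\le n}S_i$ and $M=\sup_{n\ge0}S_n$. Let $\sigma$ be a stopping time with respect to the filtration $\mathcal F_n=\sigma(S_0,\dots,S_n)$, $n\ge0$, such that almost surely $1\le\sigma<\infty$ and $S_\sigma\le0$, and put $\chi=-S_\sigma$. Then $\mathbf E e^{\gamma M}<\infty$ and $$\lim_{x\to\infty}\frac{\mathbf P(M_\sigma>x)}{\overline F(x)}=\left(1-\mathbf E e^{-\gamma\chi}\right)\frac{\mathbf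 E e^{\gamma M}}{1-\hat F(\gamma)}.$$ -/

import Mathlib

open MeasureTheory ProbabilityTheory Filter Topology
open scoped ENNReal

noncomputable section

namespace GammaWalk

/-- The tail function `x ↦ 1 - F(x) = F((x, ∞))` of a distribution `F` on `ℝ`. -/
def tail (F : Measure ℝ) (x : ℝ) : ℝ := F.real (Set.Ioi x)

/-- The exponential moment `φ_F(α) = ∫ e^{α y} dF(y)`, with values in `[0, ∞]`. -/
def expMoment (F : Measure ℝ) (α : ℝ) : ℝ≥0∞ := ∫⁻ y, ENNReal.ofReal (Real.exp (α * y)) ∂F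

/-- The class `𝓛(γ)`. -/
structure ClassL (F : Measure ℝ) (γ : ℝ) : Prop where
  tail_pos : ∀ x : ℝ, 0 < tail F x
  tendsto_ratio : ∀ k : ℝ,
    Tendsto (fun x : ℝ => tail F (x - k) / tail F x) atTop (𝓝 (Real.exp (γ * k)))

/-- The class `𝓢(γ)`: `F ∈ 𝓛(γ)`, `φ_F(γ) < ∞`, and the tail of `F * F` is asymptotically
equivalent to `2 φ_F(γ)` times the tail of `F`. -/
structure ClassS (F : Measure ℝ) (γ : ℝ) : Prop where
  classL : ClassL F γ
  expMoment_lt_top : expMoment F γ < ∞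
  conv_tail : Tendsto
    (fun x : ℝ => tail (Measure.conv F F) x / (2 * (expMoment F γ).toReal * tail F x))
    atTop (𝓝 1)

variable {Ω : Type*}

/-- The random walk `S_n`, the sum of the first `n` increments; the increments are indexed from
`0`, so that `ξ i` is the `(i + 1)`-st increment. -/
def walk (ξ : ℕ → Ω → ℝ) (n : ℕ) (ω : Ω) : ℝ := ∑ i ∈ Finset.range n, ξ i ω

/-- The running maximum `M_n = max_{0 ≤ i ≤ n} S_i`. -/
def walkMax (ξ : ℕ → Ω → ℝ) (n : ℕ) (ω : Ω) : ℝ :=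
  (Finset.range (n + 1)).sup' Finset.nonempty_range_add_one (fun i => walk ξ i ω)

/-- The global maximum `M = sup_{n ≥ 0} S_n`, as an extended real number. -/
def walkSup (ξ : ℕ → Ω → ℝ) (ω : Ω) : EReal := ⨆ n : ℕ, (walk ξ n ω : EReal)

theorem stronglyMeasurable_walk [MeasurableSpace Ω] {ξ : ℕ → Ω → ℝ}
    (hξ : ∀ n, Measurable (ξ n)) (n : ℕ) : StronglyMeasurable (walk ξ n) := by
  have h : Measurable (walk ξ n) := by
    unfold walk
    exact Finset.measurable_sum _ (fun i _ => hξ i)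
  exact h.stronglyMeasurable

/-- The filtration `𝓕_n = σ(S_0, …, S_n)` generated by the random walk. -/
def walkFiltration [m : MeasurableSpace Ω] (ξ : ℕ → Ω → ℝ) (hξ : ∀ n, Measurable (ξ n)) :
    Filtration ℕ m :=
  Filtration.natural (walk ξ) (stronglyMeasurable_walk hξ)

/-- `E e^{γ M}`, with values in `[0, ∞]`. -/
def expMomentSup [MeasurableSpace Ω] (ξ : ℕ → Ω → ℝ) (μ : Measure Ω) (γ : ℝ) : ℝ≥0∞ :=
  ∫⁻ ω, EReal.exp ((γ : EReal) * walkSup ξ ω) ∂μ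

end GammaWalk

end

/-! Let `G` be the law of `M` and φ the γ-moment of `F`. By the Markov property at time σ, on `M_σ ≤
x` the event `M > x` means that the walk restarted at σ climbs above `x - S_σ`. Hence P(M_σ > x) =
tail G x - E[tail G (x + χ); M_σ ≤ x] (`measureReal_lt_walkMax_stopped`). If tail G ~ C · tail F
with C = E e^{γM} / (1 - φ), then tail G (x + χ) / tail F x tends to C e^{-γχ}. As χ ≥ 0 and tail G
≤ K · tail F, dominated convergence gives the claim.

The asymptotics of tail G come from Lindley's equation M = max(0, ξ + M'), that is, tail G = tail (F
∗ G) on [0, ∞). Split the convolution by whether ξ ≤ x - a (`tail_conv_eq_add`). The part ξ > x - a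
is about E e^{γM} tail F x. In the other part tail G is evaluated only beyond a, where it compares
with tail F, and by `ClassS` this costs a factor close to φ for large a. So L = limsup and l =
liminf of tail G / tail F satisfy L ≤ φL + E e^{γM} and l ≥ φl + E e^{γM}, and φ < 1 forces L = l =
C (`ClassS.tendsto_tail_ratio_of_fixedPoint`). That L is finite follows by running the same
contraction along the finite-horizon maxima (`ClassS.exists_uniform_tail_bound`). -/

noncomputable section

namespace GammaWalk

/-! ### Convolution tails and the class 𝓢(γ). -/

section Tail

theorem tail_nonneg (F : Measure ℝ) (x : ℝ) : 0 ≤ tail F x := measureReal_nonneg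

theorem tail_le_one (F : Measure ℝ) [IsProbabilityMeasure F] (x : ℝ) : tail F x ≤ 1 :=
  measureReal_le_one

theorem antitone_tail (F : Measure ℝ) [IsFiniteMeasure F] : Antitone (tail F) :=
  fun _ _ h => measureReal_mono (Set.Ioi_subset_Ioi h)

theorem measurable_tail (F : Measure ℝ) [IsFiniteMeasure F] : Measurable (tail F) :=
  (antitone_tail F).measurable

theorem integrable_tail_comp {α : Type*} [MeasurableSpace α] (ν : Measure α) [IsFiniteMeasure ν]
    (F : Measure ℝ) [IsProbabilityMeasure F] {f : α → ℝ} (hf : Measurable f) :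
    Integrable (fun y => tail F (f y)) ν := by
  refine Integrable.of_bound ((measurable_tail F).comp hf).aestronglyMeasurable 1 ?_
  filter_upwards with y
  rw [Real.norm_of_nonneg (tail_nonneg _ _)]
  exact tail_le_one _ _

theorem measureReal_prod_eq_integral {α β : Type*} [MeasurableSpace α] [MeasurableSpace β]
    (ν : Measure α) (ρ : Measure β) [IsFiniteMeasure ν] [IsFiniteMeasure ρ]
    {s : Set (α × β)} (hs : MeasurableSet s) :
    (ν.prod ρ).real s = ∫ x, ρ.real (Prod.mk x ⁻¹' s) ∂ν := by
  rw [measureReal_def, Measure.prod_apply hs]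
  simp only [measureReal_def]
  rw [integral_toReal (measurable_measure_prodMk_left hs).aemeasurable]
  filter_upwards with x
  exact measure_lt_top _ _

theorem measureReal_prod_eq_integral_symm {α β : Type*} [MeasurableSpace α] [MeasurableSpace β]
    (ν : Measure α) (ρ : Measure β) [IsFiniteMeasure ν] [IsFiniteMeasure ρ]
    {s : Set (α × β)} (hs : MeasurableSet s) :
    (ν.prod ρ).real s = ∫ y, ν.real ((fun x => (x, y)) ⁻¹' s) ∂ρ := by
  rw [measureReal_def, Measure.prod_apply_symm hs]
  simp only [measureReal_def]
  rw [integral_toReal (measurable_measure_prodMk_right hs).aemeasurable]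
  filter_upwards with x
  exact measure_lt_top _ _

/-- Split by whether the first summand is at most x - a. If it exceeds x - a, the two lower bounds x
- a and x - m merge into x - min m a, so the shift of `tail F` is at most a and the ratio limit in
`ClassL` can be dominated. -/
theorem tail_conv_eq_add (F G : Measure ℝ) [IsProbabilityMeasure F] [IsProbabilityMeasure G]
    (x a : ℝ) :
    tail (F.conv G) x =
      (∫ y in Set.Iic (x - a), tail G (x - y) ∂F) + ∫ m, tail F (x - min m a) ∂G := by
  have hS : MeasurableSet {p : ℝ × ℝ | x < p.1 + p.2} :=
    measurableSet_lt measurable_const (measurable_fst.add measurable_snd)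
  have hA : MeasurableSet {p : ℝ × ℝ | p.1 ≤ x - a} :=
    measurableSet_le measurable_fst measurable_const
  have h0 : tail (F.conv G) x = (F.prod G).real {p : ℝ × ℝ | x < p.1 + p.2} := by
    rw [tail, Measure.conv, map_measureReal_apply (by fun_prop) measurableSet_Ioi]
    rfl
  rw [h0, ← measureReal_inter_add_sdiff hA, measureReal_prod_eq_integral _ _ (hS.inter hA),
    measureReal_prod_eq_integral_symm _ _ (hS.diff hA)]
  congr 1
  · rw [← integral_indicator measurableSet_Iic]
    congr 1 with y
    by_cases hy : y ≤ x - a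
    · rw [Set.indicator_of_mem (by exact hy), tail]
      congr 1
      ext m
      simp [hy, sub_lt_iff_lt_add']
    · rw [Set.indicator_of_notMem (by exact hy)]
      simp [hy]
  · congr 1 with m
    rw [tail]
    congr 1
    ext y
    simp only [Set.mem_preimage, Set.mem_sdiff, Set.mem_ofPred_eq, not_le, Set.mem_Ioi]
    rcases le_total m a with h | h
    · rw [min_eq_left h]
      constructor
      · rintro ⟨h1, h2⟩; linarith
      · intro h1; constructor <;> linarith
    · rw [min_eq_right h]
      constructor
      · rintro ⟨h1, h2⟩; linarith
      · intro h1; constructor <;> linarith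

theorem tendsto_integral_tail_sub_min {F : Measure ℝ} [IsProbabilityMeasure F] {γ : ℝ}
    (hF : ClassL F γ) (G : Measure ℝ) [IsProbabilityMeasure G] (a : ℝ) :
    Tendsto (fun x => (∫ m, tail F (x - min m a) ∂G) / tail F x) atTop
      (𝓝 (∫ m, Real.exp (γ * min m a) ∂G)) := by
  simp_rw [← integral_div]
  refine tendsto_integral_filter_of_dominated_convergence
    (fun _ => Real.exp (γ * a) + 1) ?_ ?_ (integrable_const _) ?_
  · filter_upwards with x
    exact (((measurable_tail F).comp (by fun_prop)).div_const _).aestronglyMeasurable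
  · filter_upwards [(hF.tendsto_ratio a).eventually_le_const (lt_add_one _)] with x hx
    filter_upwards with m
    rw [Real.norm_of_nonneg (div_nonneg (tail_nonneg _ _) (tail_nonneg _ _))]
    refine le_trans ?_ hx
    have := hF.tail_pos x
    gcongr
    exact antitone_tail F (by linarith [min_le_right m a])
  · filter_upwards with m
    exact hF.tendsto_ratio _

theorem tendsto_integral_exp_min {γ : ℝ} (hγ : 0 < γ) {G : Measure ℝ}
    (hG : Integrable (fun y => Real.exp (γ * y)) G) :
    Tendsto (fun a => ∫ m, Real.exp (γ * min m a) ∂G) atTop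
      (𝓝 (∫ m, Real.exp (γ * m) ∂G)) := by
  refine tendsto_integral_filter_of_dominated_convergence
    (fun y => Real.exp (γ * y)) ?_ ?_ hG ?_
  · filter_upwards with a
    exact Measurable.aestronglyMeasurable (by fun_prop)
  · filter_upwards with a
    filter_upwards with m
    rw [Real.norm_of_nonneg (Real.exp_pos _).le]
    gcongr
    exact min_le_left _ _
  · filter_upwards with m
    refine tendsto_const_nhds.congr' ?_
    filter_upwards [eventually_ge_atTop m] with a ha
    rw [min_eq_left ha]

theorem integrable_exp_of_expMoment_lt_top {F : Measure ℝ} {γ : ℝ} (h : expMoment F γ < ∞) :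
    Integrable (fun y => Real.exp (γ * y)) F := by
  refine ⟨Measurable.aestronglyMeasurable (by fun_prop), ?_⟩
  rw [hasFiniteIntegral_iff_ofReal (by filter_upwards with y using (Real.exp_pos _).le)]
  exact h

theorem toReal_expMoment (F : Measure ℝ) (γ : ℝ) :
    (expMoment F γ).toReal = ∫ y, Real.exp (γ * y) ∂F := by
  rw [integral_eq_lintegral_of_nonneg_ae (by filter_upwards with y using (Real.exp_pos _).le)
    (Measurable.aestronglyMeasurable (by fun_prop))]
  rfl

theorem toReal_expMoment_pos {F : Measure ℝ} [IsProbabilityMeasure F] {γ : ℝ}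
    (h : expMoment F γ < ∞) : 0 < (expMoment F γ).toReal := by
  rw [toReal_expMoment]
  exact integral_exp_pos (integrable_exp_of_expMoment_lt_top h)

/-- Apply the splitting to F ∗ F: the total is known from `ClassS`, the truncated part from
`ClassL`, and the difference remains. -/
theorem ClassS.tendsto_setIntegral_tail {F : Measure ℝ} [IsProbabilityMeasure F] {γ : ℝ}
    (hF : ClassS F γ) (a : ℝ) :
    Tendsto (fun x => (∫ y in Set.Iic (x - a), tail F (x - y) ∂F) / tail F x) atTop
      (𝓝 (2 * (expMoment F γ).toReal - ∫ m, Real.exp (γ * min m a) ∂F)) := by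
  have hφ := toReal_expMoment_pos hF.expMoment_lt_top
  have h1 := hF.conv_tail.const_mul (2 * (expMoment F γ).toReal)
  rw [mul_one] at h1
  refine (h1.sub (tendsto_integral_tail_sub_min hF.classL F a)).congr fun x => ?_
  have hx := hF.classL.tail_pos x
  rw [tail_conv_eq_add F F x a]
  field_simp
  ring

theorem ClassS.tendsto_truncation {F : Measure ℝ} {γ : ℝ} (hγ : 0 < γ) (hF : ClassS F γ) :
    Tendsto (fun a => 2 * (expMoment F γ).toReal - ∫ m, Real.exp (γ * min m a) ∂F) atTop
      (𝓝 (expMoment F γ).toReal) := by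
  have h := (tendsto_integral_exp_min hγ
    (integrable_exp_of_expMoment_lt_top hF.expMoment_lt_top)).const_sub
    (2 * (expMoment F γ).toReal)
  rw [← toReal_expMoment] at h
  convert h using 2
  ring

/-- A sequence of distributions satisfying the finite-horizon Lindley recursion
has tails uniformly bounded by a multiple of the tail of the increments. -/
theorem ClassS.exists_uniform_tail_bound {F : Measure ℝ} [IsProbabilityMeasure F] {γ : ℝ}
    (hγ : 0 < γ) (hF : ClassS F γ) (hF1 : expMoment F γ < 1)
    (G : ℕ → Measure ℝ) [∀ n, IsProbabilityMeasure (G n)]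
    (h0 : ∀ x, 0 ≤ x → tail (G 0) x = 0)
    (hrec : ∀ n x, 0 ≤ x → tail (G (n + 1)) x = tail (F.conv (G n)) x) :
    ∃ K, ∀ n x, tail (G n) x ≤ K * tail F x := by
  have hφ1 : (expMoment F γ).toReal < 1 := by
    rw [← ENNReal.toReal_one]
    exact ENNReal.toReal_strict_mono ENNReal.one_ne_top hF1
  obtain ⟨ρ, hρ, hρ1⟩ := exists_between hφ1
  obtain ⟨a, ha⟩ := ((hF.tendsto_truncation hγ).eventually_lt_const hρ).exists
  obtain ⟨x₁, hx₁0, hx₁⟩ := ((((hF.tendsto_setIntegral_tail a).eventually_le_const ha).and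
    ((hF.classL.tendsto_ratio a).eventually_le_const (lt_add_one _))).and
    (eventually_ge_atTop 0)).exists_forall_of_atTop.imp
    fun x₁ h => And.intro (h x₁ le_rfl).2 fun x hx => (h x hx).1
  set D := Real.exp (γ * a) + 1
  have hpos := hF.classL.tail_pos
  have hD : 0 < D := by positivity
  -- The first entry makes the bound trivial for x ≤ x₁, where tails are at most 1. The second gives
  -- K ρ + D ≤ K, which closes the induction beyond x₁.
  set K := max (1 / tail F x₁) (D / (1 - ρ))
  have hK1 : 1 ≤ K * tail F x₁ := by
    rw [← div_le_iff₀ (hpos _)]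
    exact le_max_left _ _
  have hK2 : K * ρ + D ≤ K := by
    have : D / (1 - ρ) ≤ K := le_max_right _ _
    rw [div_le_iff₀ (by linarith)] at this
    linarith
  have hK0 : 0 ≤ K := le_trans (one_div_pos.2 (hpos x₁)).le (le_max_left _ _)
  have hsmall : ∀ n x, x ≤ x₁ → tail (G n) x ≤ K * tail F x := fun n x hx =>
    (tail_le_one _ _).trans (hK1.trans (mul_le_mul_of_nonneg_left (antitone_tail F hx) hK0))
  refine ⟨K, fun n => ?_⟩
  induction n with
  | zero =>
    intro x
    rcases le_total x x₁ with hx | hx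
    · exact hsmall 0 x hx
    · rw [h0 x (hx₁0.trans hx)]
      exact mul_nonneg hK0 (tail_nonneg _ _)
  | succ n ih =>
    intro x
    rcases le_total x x₁ with hx | hx
    · exact hsmall _ x hx
    obtain ⟨hT, hR⟩ := hx₁ x hx
    rw [div_le_iff₀ (hpos x)] at hT hR
    rw [hrec n x (hx₁0.trans hx), tail_conv_eq_add F (G n) x a]
    have e1 : ∫ y in Set.Iic (x - a), tail (G n) (x - y) ∂F ≤ K * (ρ * tail F x) := by
      refine le_trans ?_ (mul_le_mul_of_nonneg_left hT hK0)
      rw [← integral_const_mul]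
      refine integral_mono (integrable_tail_comp _ _ (by fun_prop))
        ((integrable_tail_comp _ _ (by fun_prop)).const_mul _) fun y => ih (x - y)
    have e2 : ∫ m, tail F (x - min m a) ∂(G n) ≤ D * tail F x := by
      refine le_trans ?_ hR
      have : ∫ m, tail F (x - min m a) ∂(G n) ≤ ∫ _, tail F (x - a) ∂(G n) :=
        integral_mono (integrable_tail_comp _ _ (by fun_prop)) (integrable_const _)
          fun m => antitone_tail F (by linarith [min_le_right m a])
      simpa using this
    calc _ ≤ K * (ρ * tail F x) + D * tail F x := add_le_add e1 e2
      _ = (K * ρ + D) * tail F x := by ring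
      _ ≤ K * tail F x := mul_le_mul_of_nonneg_right hK2 (tail_nonneg _ _)

/-- Tail asymptotics of a solution of the stationary Lindley equation. -/
theorem ClassS.tendsto_tail_ratio_of_fixedPoint {F : Measure ℝ} [IsProbabilityMeasure F] {γ : ℝ}
    (hγ : 0 < γ) (hF : ClassS F γ) (hF1 : expMoment F γ < 1)
    (G : Measure ℝ) [IsProbabilityMeasure G] (hG : Integrable (fun y => Real.exp (γ * y)) G)
    (hfix : ∀ x, 0 ≤ x → tail G x = tail (F.conv G) x)
    {K : ℝ} (hK : ∀ x, tail G x ≤ K * tail F x) :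
    Tendsto (fun x => tail G x / tail F x) atTop
      (𝓝 ((∫ y, Real.exp (γ * y) ∂G) / (1 - (expMoment F γ).toReal))) := by
  have hφ1 : (expMoment F γ).toReal < 1 := by
    rw [← ENNReal.toReal_one]
    exact ENNReal.toReal_strict_mono ENNReal.one_ne_top hF1
  set φ := (expMoment F γ).toReal
  set B := ∫ y, Real.exp (γ * y) ∂G
  have hpos := hF.classL.tail_pos
  set r : ℝ → ℝ := fun x => tail G x / tail F x
  have hr0 : ∀ x, 0 ≤ r x := fun x => div_nonneg (tail_nonneg _ _) (tail_nonneg _ _)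
  have hrK : ∀ x, r x ≤ K := fun x => (div_le_iff₀ (hpos x)).2 (hK x)
  have hbd1 : IsBoundedUnder (· ≤ ·) atTop r := isBoundedUnder_of ⟨K, hrK⟩
  have hbd2 : IsBoundedUnder (· ≥ ·) atTop r := isBoundedUnder_of ⟨0, hr0⟩
  have hlim : ∀ c a, Tendsto (fun x => c * ((∫ y in Set.Iic (x - a), tail F (x - y) ∂F) / tail F x)
      + (∫ m, tail F (x - min m a) ∂G) / tail F x) atTop
      (𝓝 (c * (2 * φ - ∫ m, Real.exp (γ * min m a) ∂F) + ∫ m, Real.exp (γ * min m a) ∂G)) :=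
    fun c a => ((hF.tendsto_setIntegral_tail a).const_mul c).add
      (tendsto_integral_tail_sub_min hF.classL G a)
  have hlim2 : ∀ c, Tendsto (fun a => c * (2 * φ - ∫ m, Real.exp (γ * min m a) ∂F)
      + ∫ m, Real.exp (γ * min m a) ∂G) atTop (𝓝 (c * φ + B)) :=
    fun c => ((hF.tendsto_truncation hγ).const_mul c).add (tendsto_integral_exp_min hγ hG)
  have hr : ∀ x, 0 ≤ x → ∀ a, r x = (∫ y in Set.Iic (x - a), tail G (x - y) ∂F) / tail F x +
      (∫ m, tail F (x - min m a) ∂G) / tail F x := fun x hx a => by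
    rw [← add_div, ← tail_conv_eq_add, ← hfix x hx]
  -- Beyond some z, tail G ≤ c · tail F. For a ≥ z the range y ≤ x - a keeps x - y ≥ z, so the
  -- comparison holds under the integral. Then x → ∞, and afterwards a → ∞.
  have hup : ∀ c, limsup r atTop < c → limsup r atTop ≤ c * φ + B := by
    intro c hc
    obtain ⟨z, hz⟩ := (eventually_lt_of_limsup_lt hc hbd1).exists_forall_of_atTop
    refine ge_of_tendsto (hlim2 c) ?_
    filter_upwards [eventually_ge_atTop z] with a ha
    rw [← (hlim c a).limsup_eq]
    refine limsup_le_limsup ?_ hbd2.isCoboundedUnder_le (hlim c a).isBoundedUnder_le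
    filter_upwards [eventually_ge_atTop 0] with x hx
    rw [hr x hx a, ← mul_div_assoc, ← integral_const_mul]
    gcongr ?_ / _ + _
    · exact (hpos x).le
    refine setIntegral_mono_on (integrable_tail_comp _ _ (by fun_prop))
      ((integrable_tail_comp _ _ (by fun_prop)).const_mul _) measurableSet_Iic fun y hy => ?_
    have := (hz (x - y) (by have := Set.mem_Iic.1 hy; linarith)).le
    exact (div_le_iff₀ (hpos _)).1 this
  have hlow : ∀ c, c < liminf r atTop → c * φ + B ≤ liminf r atTop := by
    intro c hc
    obtain ⟨z, hz⟩ := (eventually_lt_of_lt_liminf hc hbd2).exists_forall_of_atTop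
    refine le_of_tendsto (hlim2 c) ?_
    filter_upwards [eventually_ge_atTop z] with a ha
    rw [← (hlim c a).liminf_eq]
    refine liminf_le_liminf ?_ (hlim c a).isBoundedUnder_ge hbd1.isCoboundedUnder_ge
    filter_upwards [eventually_ge_atTop 0] with x hx
    rw [hr x hx a, ← mul_div_assoc, ← integral_const_mul]
    gcongr ?_ / _ + _
    · exact (hpos x).le
    refine setIntegral_mono_on ((integrable_tail_comp _ _ (by fun_prop)).const_mul _)
      (integrable_tail_comp _ _ (by fun_prop)) measurableSet_Iic fun y hy => ?_
    have := (hz (x - y) (by have := Set.mem_Iic.1 hy; linarith)).le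
    exact (le_div_iff₀ (hpos _)).1 this
  -- Letting c tend to the liminf from below and to the limsup from above turns `hlow` and `hup`
  -- into inequalities for these values themselves.
  refine tendsto_of_le_liminf_of_limsup_le ?_ ?_ hbd1 hbd2
  · rw [div_le_iff₀ (by linarith)]
    have h : (liminf r atTop) * φ + B ≤ liminf r atTop :=
      le_of_tendsto (f := fun c => c * φ + B) (x := 𝓝[<] (liminf r atTop))
        (((continuous_id.mul continuous_const).add continuous_const).continuousWithinAt)
        (by filter_upwards [self_mem_nhdsWithin] with c hc using hlow c hc)
    linarith
  · rw [le_div_iff₀ (by linarith)]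
    have h : limsup r atTop ≤ (limsup r atTop) * φ + B :=
      ge_of_tendsto (f := fun c => c * φ + B) (x := 𝓝[>] (limsup r atTop))
        (((continuous_id.mul continuous_const).add continuous_const).continuousWithinAt)
        (by filter_upwards [self_mem_nhdsWithin] with c hc using hup c hc)
    linarith

end Tail

variable {Ω : Type*}

/-! ### Pathwise identities for the walk, independence, and the supremum. -/

section Walk

/-- The increments after time `k`. -/
def shift (ξ : ℕ → Ω → ℝ) (k i : ℕ) : Ω → ℝ := ξ (k + i)

/-- The supremum of the walk as a real number (meaningful when the walk is bounded above). -/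
def walkSupReal (ξ : ℕ → Ω → ℝ) (ω : Ω) : ℝ := ⨆ n, walk ξ n ω

theorem walk_zero (ξ : ℕ → Ω → ℝ) (ω : Ω) : walk ξ 0 ω = 0 := by simp [walk]

theorem walk_add (ξ : ℕ → Ω → ℝ) (k n : ℕ) (ω : Ω) :
    walk ξ (k + n) ω = walk ξ k ω + walk (shift ξ k) n ω := by
  simp [walk, shift, Finset.sum_range_add]

theorem walk_one_add (ξ : ℕ → Ω → ℝ) (n : ℕ) (ω : Ω) :
    walk ξ (1 + n) ω = ξ 0 ω + walk (shift ξ 1) n ω := by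
  rw [walk_add]; simp [walk]

theorem lt_walkMax_iff {ξ : ℕ → Ω → ℝ} {n : ℕ} {ω : Ω} {x : ℝ} :
    x < walkMax ξ n ω ↔ ∃ i ≤ n, x < walk ξ i ω := by
  simp [walkMax, Finset.lt_sup'_iff]

theorem lt_walkSupReal_iff {ξ : ℕ → Ω → ℝ} {ω : Ω}
    (h : BddAbove (Set.range fun n => walk ξ n ω)) {x : ℝ} :
    x < walkSupReal ξ ω ↔ ∃ i, x < walk ξ i ω :=
  lt_ciSup_iff h

theorem bddAbove_shift {ξ : ℕ → Ω → ℝ} {ω : Ω}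
    (h : BddAbove (Set.range fun n => walk ξ n ω)) (k : ℕ) :
    BddAbove (Set.range fun n => walk (shift ξ k) n ω) := by
  obtain ⟨b, hb⟩ := h
  refine ⟨b - walk ξ k ω, ?_⟩
  rintro _ ⟨n, rfl⟩
  have := hb ⟨k + n, rfl⟩
  simp only [walk_add] at this
  linarith

/-- Lindley's recursion; x ≥ 0 rules out the index 0, where the walk vanishes. -/
theorem lt_walkMax_succ_iff {ξ : ℕ → Ω → ℝ} {n : ℕ} {ω : Ω} {x : ℝ} (hx : 0 ≤ x) :
    x < walkMax ξ (n + 1) ω ↔ x < ξ 0 ω + walkMax (shift ξ 1) n ω := by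
  rw [← sub_lt_iff_lt_add', lt_walkMax_iff, lt_walkMax_iff]
  simp only [sub_lt_iff_lt_add', ← walk_one_add]
  constructor
  · rintro ⟨i, hi, h⟩
    rcases i with _ | i
    · rw [walk_zero] at h; linarith
    · exact ⟨i, by omega, by rwa [add_comm 1 i]⟩
  · rintro ⟨i, hi, h⟩
    exact ⟨1 + i, by omega, h⟩

theorem lt_walkSupReal_iff_shift {ξ : ℕ → Ω → ℝ} {ω : Ω}
    (h : BddAbove (Set.range fun n => walk ξ n ω)) (k : ℕ) {x : ℝ} :
    x < walkSupReal ξ ω ↔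
      x < walkMax ξ k ω ∨ x - walk ξ k ω < walkSupReal (shift ξ k) ω := by
  rw [lt_walkSupReal_iff h, lt_walkMax_iff, lt_walkSupReal_iff (bddAbove_shift h k)]
  simp only [sub_lt_iff_lt_add', ← walk_add]
  constructor
  · rintro ⟨i, hi⟩
    rcases le_total i k with h | h
    · exact Or.inl ⟨i, h, hi⟩
    · exact Or.inr ⟨i - k, by rwa [Nat.add_sub_cancel' h]⟩
  · rintro (⟨i, -, hi⟩ | ⟨i, hi⟩)
    exacts [⟨i, hi⟩, ⟨_, hi⟩]

theorem walkSupReal_nonneg {ξ : ℕ → Ω → ℝ} {ω : Ω}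
    (h : BddAbove (Set.range fun n => walk ξ n ω)) : 0 ≤ walkSupReal ξ ω :=
  (walk_zero ξ ω).ge.trans (le_ciSup h 0)

theorem lt_walkSupReal_iff_add {ξ : ℕ → Ω → ℝ} {ω : Ω}
    (h : BddAbove (Set.range fun n => walk ξ n ω)) {x : ℝ} (hx : 0 ≤ x) :
    x < walkSupReal ξ ω ↔ x < ξ 0 ω + walkSupReal (shift ξ 1) ω := by
  rw [lt_walkSupReal_iff_shift h 1, lt_walkMax_succ_iff hx, sub_lt_iff_lt_add']
  have h1 : walk ξ 1 ω = ξ 0 ω := by simp [walk]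
  have h2 : walkMax (shift ξ 1) 0 ω = 0 := by simp [walkMax, walk]
  have := walkSupReal_nonneg (bddAbove_shift h 1)
  rw [h1, h2]
  constructor
  · rintro (h | h) <;> linarith
  · exact Or.inr

theorem walkSup_eq_coe {ξ : ℕ → Ω → ℝ} {ω : Ω}
    (h : BddAbove (Set.range fun n => walk ξ n ω)) :
    walkSup ξ ω = (walkSupReal ξ ω : EReal) := by
  refine le_antisymm (iSup_le fun n => EReal.coe_le_coe_iff.2 (le_ciSup h n)) ?_
  refine le_of_forall_lt fun c hc => ?_
  induction c with
  | bot => exact lt_of_lt_of_le (EReal.bot_lt_coe _) (le_iSup (fun n => (walk ξ n ω : EReal)) 0)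
  | top => exact absurd hc (by simp)
  | coe c =>
    obtain ⟨i, hi⟩ := (lt_walkSupReal_iff h).1 (EReal.coe_lt_coe_iff.1 hc)
    exact (EReal.coe_lt_coe_iff.2 hi).trans_le (le_iSup (fun n => (walk ξ n ω : EReal)) i)

theorem measurable_shift {ξ : ℕ → Ω → ℝ} (k i : ℕ) :
    Measurable[⨆ i ∈ Set.Ici k, MeasurableSpace.comap (ξ i) inferInstance] (shift ξ k i) := by
  refine Measurable.mono (comap_measurable (ξ (k + i))) ?_ le_rfl
  exact le_iSup₂_of_le (k + i) (by simp) le_rfl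

theorem measurable_past_zero {ξ : ℕ → Ω → ℝ} :
    Measurable[⨆ i ∈ Set.Iio 1, MeasurableSpace.comap (ξ i) inferInstance] (ξ 0) :=
  Measurable.mono (comap_measurable (ξ 0)) (le_iSup₂_of_le 0 (by simp) le_rfl) le_rfl

/-- Each term is at most the whole series. The bound does not depend on n, so it also bounds the
supremum. -/
theorem walk_le_of_tsum {ξ : ℕ → Ω → ℝ} {γ : ℝ} (hγ : 0 < γ) {ω : Ω}
    (h : ∑' n, ENNReal.ofReal (Real.exp (γ * walk ξ n ω)) < ∞) (n : ℕ) :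
    walk ξ n ω ≤ Real.log (∑' n, ENNReal.ofReal (Real.exp (γ * walk ξ n ω))).toReal / γ := by
  have h1 := (ENNReal.ofReal_le_iff_le_toReal h.ne).1
    (ENNReal.le_tsum (f := fun n => ENNReal.ofReal (Real.exp (γ * walk ξ n ω))) n)
  rw [le_div_iff₀ hγ, Real.le_log_iff_exp_le ((Real.exp_pos _).trans_le h1), mul_comm]
  exact h1

/-- The σ-algebra is left free so that this and the next two lemmas also apply to the σ-algebra of
the future increments and to sequence space. -/
theorem measurable_walk {_ : MeasurableSpace Ω} {ξ : ℕ → Ω → ℝ} (hξ : ∀ n, Measurable (ξ n)) (n : ℕ) :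
    Measurable (walk ξ n) := Finset.measurable_sum _ fun i _ => hξ i

theorem measurable_walkMax {_ : MeasurableSpace Ω} {ξ : ℕ → Ω → ℝ} (hξ : ∀ n, Measurable (ξ n)) (n : ℕ) :
    Measurable (walkMax ξ n) := by
  have := Finset.measurable_sup' (s := Finset.range (n + 1)) Finset.nonempty_range_add_one
    (f := walk ξ) fun i _ => measurable_walk hξ i
  convert this using 1
  ext ω
  simp [walkMax, Finset.sup'_apply]

theorem measurable_walkSupReal {_ : MeasurableSpace Ω} {ξ : ℕ → Ω → ℝ} (hξ : ∀ n, Measurable (ξ n)) :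
    Measurable (walkSupReal ξ) := Measurable.iSup (measurable_walk hξ)

variable [MeasurableSpace Ω]

theorem iSup_comap_ge_le {ξ : ℕ → Ω → ℝ} (hξ : ∀ n, Measurable (ξ n)) (k : ℕ) :
    (⨆ i ∈ Set.Ici k, MeasurableSpace.comap (ξ i) inferInstance) ≤ ‹MeasurableSpace Ω› :=
  iSup₂_le fun i _ => (hξ i).comap_le

theorem walkFiltration_le {ξ : ℕ → Ω → ℝ} (hξ : ∀ n, Measurable (ξ n)) (k : ℕ) :
    walkFiltration ξ hξ k ≤ ⨆ i ∈ Set.Iio k, MeasurableSpace.comap (ξ i) inferInstance := by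
  refine iSup₂_le fun j hj => ?_
  refine Measurable.comap_le ?_
  refine Finset.measurable_sum (Finset.range j) fun i hi => ?_
  refine Measurable.mono (comap_measurable (ξ i)) ?_ le_rfl
  exact le_iSup₂_of_le i ((Finset.mem_range.1 hi).trans_le hj) le_rfl

variable {μ : Measure Ω}

/-- The walk after time `k` is independent of the past. -/
theorem indepFun_of_measurable_past_future {ξ : ℕ → Ω → ℝ} (hξ : ∀ n, Measurable (ξ n))
    (hindep : iIndepFun ξ μ) {β β' : Type*} [MeasurableSpace β] [MeasurableSpace β'] (k : ℕ)
    {X : Ω → β} {Z : Ω → β'}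
    (hX : Measurable[⨆ i ∈ Set.Iio k, MeasurableSpace.comap (ξ i) inferInstance] X)
    (hZ : Measurable[⨆ i ∈ Set.Ici k, MeasurableSpace.comap (ξ i) inferInstance] Z) :
    IndepFun X Z μ := by
  have h := indep_iSup_of_disjoint (fun i => (hξ i).comap_le) (hindep.iIndep)
    (S := Set.Iio k) (T := Set.Ici k) (Set.Iio_disjoint_Ici le_rfl)
  exact (IndepFun_iff_Indep _ _ _).2
    (indep_of_indep_of_le_right (indep_of_indep_of_le_left h hX.comap_le) hZ.comap_le)

theorem tail_map {Z : Ω → ℝ} (hZ : Measurable Z) (x : ℝ) :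
    tail (μ.map Z) x = μ.real {ω | x < Z ω} := map_measureReal_apply hZ measurableSet_Ioi

theorem expMomentSup_eq {ξ : ℕ → Ω → ℝ} (hξ : ∀ n, Measurable (ξ n))
    (hbdd : ∀ᵐ ω ∂μ, BddAbove (Set.range fun n => walk ξ n ω)) (γ : ℝ) :
    expMomentSup ξ μ γ = expMoment (μ.map (walkSupReal ξ)) γ := by
  rw [expMoment, lintegral_map (by fun_prop) (measurable_walkSupReal hξ)]
  refine lintegral_congr_ae ?_
  filter_upwards [hbdd] with ω hω
  rw [walkSup_eq_coe hω, ← EReal.coe_mul, EReal.exp_coe]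

variable [IsProbabilityMeasure μ] {F : Measure ℝ}

theorem measureReal_indepFun_eq_integral {β β' : Type*} [MeasurableSpace β] [MeasurableSpace β']
    {X : Ω → β} {Z : Ω → β'} (hX : Measurable X) (hZ : Measurable Z) (h : IndepFun X Z μ)
    {s : Set (β × β')} (hs : MeasurableSet s) :
    μ.real {ω | (X ω, Z ω) ∈ s} = ∫ ω, (μ.map Z).real (Prod.mk (X ω) ⁻¹' s) ∂μ := by
  have h1 : μ.real {ω | (X ω, Z ω) ∈ s} = (μ.map fun ω => (X ω, Z ω)).real s :=
    (map_measureReal_apply (hX.prodMk hZ) hs).symm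
  have : IsProbabilityMeasure (μ.map X) := Measure.isProbabilityMeasure_map hX.aemeasurable
  have : IsProbabilityMeasure (μ.map Z) := Measure.isProbabilityMeasure_map hZ.aemeasurable
  rw [h1, (indepFun_iff_map_prod_eq_prod_map_map hX.aemeasurable hZ.aemeasurable).1 h,
    measureReal_prod_eq_integral _ _ hs, integral_map hX.aemeasurable]
  exact (measurable_measure_prodMk_left hs).ennreal_toReal.aestronglyMeasurable

theorem tail_conv_map {ξ : ℕ → Ω → ℝ} (hξ : ∀ n, Measurable (ξ n)) (hindep : iIndepFun ξ μ)
    (hlaw : ∀ n, μ.map (ξ n) = F) {Z : Ω → ℝ}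
    (hZ : Measurable[⨆ i ∈ Set.Ici 1, MeasurableSpace.comap (ξ i) inferInstance] Z) (x : ℝ) :
    tail (F.conv (μ.map Z)) x = μ.real {ω | x < ξ 0 ω + Z ω} := by
  have hZ' : Measurable Z := hZ.mono (iSup_comap_ge_le hξ 1) le_rfl
  rw [← hlaw 0, ← IndepFun.map_add_eq_map_conv_map (hξ 0) hZ'
    (indepFun_of_measurable_past_future hξ hindep 1 measurable_past_zero hZ),
    tail_map ((hξ 0).add hZ')]
  rfl

/-- Functionals of the increments are stationary under shifts. -/
theorem map_shift_eq {ξ : ℕ → Ω → ℝ} (hξ : ∀ n, Measurable (ξ n)) (hindep : iIndepFun ξ μ)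
    (hlaw : ∀ n, μ.map (ξ n) = F) {Φ : (ℕ → ℝ) → ℝ} (hΦ : Measurable Φ) (k : ℕ) :
    μ.map (fun ω => Φ fun i => shift ξ k i ω) = μ.map (fun ω => Φ fun i => ξ i ω) := by
  have h1 := (iIndepFun_iff_map_fun_eq_infinitePi_map hξ).1 hindep
  have hs : iIndepFun (shift ξ k) μ := hindep.precomp (g := fun i => k + i) (add_right_injective k)
  have h2 := (iIndepFun_iff_map_fun_eq_infinitePi_map fun i => hξ (k + i)).1 hs
  simp only [hlaw] at h1 h2
  have h3 := (Measure.map_map hΦ (measurable_pi_lambda _ hξ) (μ := μ)).symm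
  have h4 := (Measure.map_map hΦ (measurable_pi_lambda _ fun i => hξ (k + i)) (μ := μ)).symm
  rw [h1] at h3
  rw [h2] at h4
  exact h4.trans h3.symm

theorem map_walkMax_shift {ξ : ℕ → Ω → ℝ} (hξ : ∀ n, Measurable (ξ n)) (hindep : iIndepFun ξ μ)
    (hlaw : ∀ n, μ.map (ξ n) = F) (k n : ℕ) :
    μ.map (walkMax (shift ξ k) n) = μ.map (walkMax ξ n) :=
  -- The functional Φ is `walkMax` of the coordinate process on ℕ → ℝ.
  map_shift_eq hξ hindep hlaw (measurable_walkMax (fun i => measurable_pi_apply i) n) k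

theorem map_walkSupReal_shift {ξ : ℕ → Ω → ℝ} (hξ : ∀ n, Measurable (ξ n))
    (hindep : iIndepFun ξ μ) (hlaw : ∀ n, μ.map (ξ n) = F) (k : ℕ) :
    μ.map (walkSupReal (shift ξ k)) = μ.map (walkSupReal ξ) :=
  map_shift_eq hξ hindep hlaw (measurable_walkSupReal fun i => measurable_pi_apply i) k

theorem tail_map_walkMax_succ {ξ : ℕ → Ω → ℝ} (hξ : ∀ n, Measurable (ξ n))
    (hindep : iIndepFun ξ μ) (hlaw : ∀ n, μ.map (ξ n) = F) (n : ℕ) {x : ℝ} (hx : 0 ≤ x) :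
    tail (μ.map (walkMax ξ (n + 1))) x = tail (F.conv (μ.map (walkMax ξ n))) x := by
  rw [← map_walkMax_shift hξ hindep hlaw 1 n, tail_conv_map hξ hindep hlaw
    (measurable_walkMax (measurable_shift 1) n), tail_map (measurable_walkMax hξ _)]
  simp_rw [lt_walkMax_succ_iff hx]

theorem tail_map_walkSupReal {ξ : ℕ → Ω → ℝ} (hξ : ∀ n, Measurable (ξ n))
    (hindep : iIndepFun ξ μ) (hlaw : ∀ n, μ.map (ξ n) = F)
    (hbdd : ∀ᵐ ω ∂μ, BddAbove (Set.range fun n => walk ξ n ω)) {x : ℝ} (hx : 0 ≤ x) :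
    tail (μ.map (walkSupReal ξ)) x = tail (F.conv (μ.map (walkSupReal ξ))) x := by
  rw [← map_walkSupReal_shift hξ hindep hlaw 1, tail_conv_map hξ hindep hlaw
    (measurable_walkSupReal (measurable_shift 1)), map_walkSupReal_shift hξ hindep hlaw,
    tail_map (measurable_walkSupReal hξ)]
  refine measureReal_congr ?_
  filter_upwards [hbdd] with ω hω
  exact propext (lt_walkSupReal_iff_add hω hx)

theorem tendsto_tail_map_walkMax {ξ : ℕ → Ω → ℝ} (hξ : ∀ n, Measurable (ξ n))
    (hbdd : ∀ᵐ ω ∂μ, BddAbove (Set.range fun n => walk ξ n ω)) (x : ℝ) :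
    Tendsto (fun n => tail (μ.map (walkMax ξ n)) x) atTop
      (𝓝 (tail (μ.map (walkSupReal ξ)) x)) := by
  simp_rw [tail_map (measurable_walkMax hξ _), tail_map (measurable_walkSupReal hξ)]
  have hmono : Monotone fun n => {ω : Ω | x < walkMax ξ n ω} := fun n m h ω hω => by
    obtain ⟨i, hi, hx⟩ := lt_walkMax_iff.1 hω
    exact lt_walkMax_iff.2 ⟨i, hi.trans h, hx⟩
  have heq : μ (⋃ n, {ω | x < walkMax ξ n ω}) = μ {ω | x < walkSupReal ξ ω} := by
    refine measure_congr ?_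
    filter_upwards [hbdd] with ω hω
    refine propext ?_
    change ω ∈ (⋃ n, {ω : Ω | x < walkMax ξ n ω}) ↔ x < walkSupReal ξ ω
    rw [lt_walkSupReal_iff hω]
    simp only [Set.mem_iUnion, Set.mem_ofPred_eq, lt_walkMax_iff]
    exact ⟨fun ⟨_, i, _, h⟩ => ⟨i, h⟩, fun ⟨i, h⟩ => ⟨i, i, le_rfl, h⟩⟩
  have h := tendsto_measure_iUnion_atTop (μ := μ) hmono
  rw [heq] at h
  exact (ENNReal.tendsto_toReal (measure_ne_top _ _)).comp h

/-! ### Finiteness of the exponential moment and tail of the supremum. -/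

theorem lintegral_exp_walk {ξ : ℕ → Ω → ℝ} (hξ : ∀ n, Measurable (ξ n)) (hindep : iIndepFun ξ μ)
    (hlaw : ∀ n, μ.map (ξ n) = F) {γ : ℝ} (hF : expMoment F γ < ∞) (n : ℕ) :
    ∫⁻ ω, ENNReal.ofReal (Real.exp (γ * walk ξ n ω)) ∂μ = expMoment F γ ^ n := by
  have hint : ∀ i, Integrable (fun ω => Real.exp (γ * ξ i ω)) μ := fun i => by
    have := integrable_exp_of_expMoment_lt_top hF
    rw [← hlaw i] at this
    exact this.comp_measurable (hξ i)
  have hmgf : ∀ i, mgf (ξ i) μ γ = (expMoment F γ).toReal := fun i => by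
    rw [toReal_expMoment, ← hlaw i, integral_map (hξ i).aemeasurable
      (Measurable.aestronglyMeasurable (by fun_prop))]
    rfl
  have h1 := hindep.integrable_exp_mul_sum hξ (s := Finset.range n) fun i _ => hint i
  have h2 := hindep.mgf_sum hξ (t := γ) (Finset.range n)
  simp only [hmgf, Finset.prod_const, Finset.card_range] at h2
  simp only [mgf, Finset.sum_apply] at h1 h2
  unfold walk
  rw [← ofReal_integral_eq_lintegral_ofReal h1 (by filter_upwards with ω using (Real.exp_pos _).le),
    h2, ENNReal.ofReal_pow ENNReal.toReal_nonneg, ENNReal.ofReal_toReal hF.ne]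

theorem lintegral_tsum_exp_walk_lt_top {ξ : ℕ → Ω → ℝ} (hξ : ∀ n, Measurable (ξ n))
    (hindep : iIndepFun ξ μ) (hlaw : ∀ n, μ.map (ξ n) = F) {γ : ℝ} (hF1 : expMoment F γ < 1) :
    ∫⁻ ω, ∑' n, ENNReal.ofReal (Real.exp (γ * walk ξ n ω)) ∂μ < ∞ := by
  rw [lintegral_tsum fun n =>
    (((measurable_walk hξ n).const_mul γ).exp.ennreal_ofReal).aemeasurable]
  simp_rw [lintegral_exp_walk hξ hindep hlaw (hF1.trans ENNReal.one_lt_top)]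
  rw [ENNReal.tsum_geometric]
  exact ENNReal.inv_lt_top.2 (tsub_pos_of_lt hF1)

theorem ae_bddAbove_walk {ξ : ℕ → Ω → ℝ} (hξ : ∀ n, Measurable (ξ n))
    (hindep : iIndepFun ξ μ) (hlaw : ∀ n, μ.map (ξ n) = F) {γ : ℝ} (hγ : 0 < γ)
    (hF1 : expMoment F γ < 1) : ∀ᵐ ω ∂μ, BddAbove (Set.range fun n => walk ξ n ω) := by
  have hm : Measurable fun ω => ∑' n, ENNReal.ofReal (Real.exp (γ * walk ξ n ω)) :=
    Measurable.tsum fun n => ((measurable_walk hξ n).const_mul γ).exp.ennreal_ofReal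
  filter_upwards [ae_lt_top hm (lintegral_tsum_exp_walk_lt_top hξ hindep hlaw hF1).ne] with ω hω
  exact ⟨_, Set.forall_mem_range.2 (walk_le_of_tsum hγ hω)⟩

/-- Pathwise e^{γM} ≤ Σ e^{γ S_n}, and the expected sum is a geometric series of ratio φ < 1. -/
theorem expMomentSup_lt_top {ξ : ℕ → Ω → ℝ} (hξ : ∀ n, Measurable (ξ n))
    (hindep : iIndepFun ξ μ) (hlaw : ∀ n, μ.map (ξ n) = F) {γ : ℝ} (hγ : 0 < γ)
    (hF1 : expMoment F γ < 1) : expMomentSup ξ μ γ < ∞ := by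
  rw [expMomentSup_eq hξ (ae_bddAbove_walk hξ hindep hlaw hγ hF1), expMoment,
    lintegral_map (by fun_prop) (measurable_walkSupReal hξ)]
  refine (lintegral_mono fun ω => ?_).trans_lt
    (lintegral_tsum_exp_walk_lt_top hξ hindep hlaw hF1)
  rcases eq_or_ne (∑' n, ENNReal.ofReal (Real.exp (γ * walk ξ n ω))) ∞ with h | h
  · rw [h]; exact le_top
  have h0 := (ENNReal.ofReal_le_iff_le_toReal h).1
    (ENNReal.le_tsum (f := fun n => ENNReal.ofReal (Real.exp (γ * walk ξ n ω))) 0)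
  have hle : walkSupReal ξ ω ≤ _ := ciSup_le (walk_le_of_tsum hγ h.lt_top)
  rw [le_div_iff₀ hγ, Real.le_log_iff_exp_le ((Real.exp_pos _).trans_le h0), mul_comm] at hle
  exact (ENNReal.ofReal_le_iff_le_toReal h).2 hle

variable [IsProbabilityMeasure F]

/-- Tail asymptotics of the supremum of the random walk. -/
theorem exists_bound_and_tendsto_tail_walkSupReal {ξ : ℕ → Ω → ℝ} (hξ : ∀ n, Measurable (ξ n))
    (hindep : iIndepFun ξ μ) (hlaw : ∀ n, μ.map (ξ n) = F) {γ : ℝ} (hγ : 0 < γ)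
    (hF : ClassS F γ) (hF1 : expMoment F γ < 1) :
    (∃ K, ∀ x, tail (μ.map (walkSupReal ξ)) x ≤ K * tail F x) ∧
      Tendsto (fun x => tail (μ.map (walkSupReal ξ)) x / tail F x) atTop
        (𝓝 ((expMomentSup ξ μ γ).toReal / (1 - (expMoment F γ).toReal))) := by
  have hbdd := ae_bddAbove_walk hξ hindep hlaw hγ hF1
  have : ∀ n, IsProbabilityMeasure (μ.map (walkMax ξ n)) :=
    fun n => Measure.isProbabilityMeasure_map (measurable_walkMax hξ n).aemeasurable
  have : IsProbabilityMeasure (μ.map (walkSupReal ξ)) :=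
    Measure.isProbabilityMeasure_map (measurable_walkSupReal hξ).aemeasurable
  obtain ⟨K, hK⟩ := hF.exists_uniform_tail_bound hγ hF1 (fun n => μ.map (walkMax ξ n))
    (fun x hx => by
      rw [tail_map (measurable_walkMax hξ 0)]
      simp [walkMax, walk, hx.not_gt])
    fun n x hx => tail_map_walkMax_succ hξ hindep hlaw n hx
  have hK' : ∀ x, tail (μ.map (walkSupReal ξ)) x ≤ K * tail F x := fun x =>
    le_of_tendsto' (tendsto_tail_map_walkMax hξ hbdd x) fun n => hK n x
  refine ⟨⟨K, hK'⟩, ?_⟩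
  have hfin := expMomentSup_lt_top hξ hindep hlaw hγ hF1
  rw [expMomentSup_eq hξ hbdd] at hfin ⊢
  rw [toReal_expMoment (μ.map _)]
  exact hF.tendsto_tail_ratio_of_fixedPoint hγ hF1 _ (integrable_exp_of_expMoment_lt_top hfin)
    (fun x hx => tail_map_walkSupReal hξ hindep hlaw hbdd hx) hK'

end Walk

/-! ### The strong Markov decomposition at σ. -/

section Stopping

/-- Coding `ω ∈ A` as a `Prop`-valued coordinate lets the position and the past event enter
independence as one random variable. -/
theorem measurable_prodMk_mem {β : Type*} [MeasurableSpace β] {m : MeasurableSpace Ω} {f : Ω → β}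
    (hf : Measurable f) {A : Set Ω} (hA : MeasurableSet A) :
    Measurable fun ω => (f ω, ω ∈ A) := hf.prodMk (measurable_mem.2 hA)

variable [MeasurableSpace Ω]

theorem untopA_natCast (n : ℕ) : (n : WithTop ℕ).untopA = n := rfl

theorem measurable_untopA_of_isStoppingTime {f : Filtration ℕ ‹MeasurableSpace Ω›}
    {σ : Ω → WithTop ℕ} (hσ : IsStoppingTime f σ) : Measurable fun ω => (σ ω).untopA := by
  have hk : ∀ k : ℕ, MeasurableSet {ω | σ ω = k} := fun k => f.le k _ (hσ.measurableSet_eq k)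
  have htop : MeasurableSet {ω | σ ω = ⊤} := by
    have : {ω | σ ω = ⊤} = (⋃ k : ℕ, {ω | σ ω = k})ᶜ := by
      ext ω
      cases h : σ ω with
      | top => simp [h]
      | coe n => simp [h]
    rw [this]
    exact (MeasurableSet.iUnion hk).compl
  refine measurable_to_countable' fun k => ?_
  -- `untopA` sends ⊤ to some fixed natural number, so one of these preimages also contains `σ = ⊤`.
  have : (fun ω => (σ ω).untopA) ⁻¹' {k} =
      {ω | σ ω = k} ∪ {ω | σ ω = ⊤ ∧ (⊤ : WithTop ℕ).untopA = k} := by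
    ext ω
    cases h : σ ω with
    | top => simp [h]
    | coe n =>
      simp only [Set.mem_preimage, Set.mem_singleton_iff, Set.mem_union, Set.mem_ofPred_eq, h,
        WithTop.coe_ne_top, false_and, or_false]
      exact (WithTop.coe_inj (a := n) (b := k)).symm
  rw [this]
  exact (hk k).union (htop.inter (MeasurableSet.const _))

theorem measurable_stoppedValue_of_measurable {f : Filtration ℕ ‹MeasurableSpace Ω›}
    {σ : Ω → WithTop ℕ} (hσ : IsStoppingTime f σ) {u : ℕ → Ω → ℝ} (hu : ∀ n, Measurable (u n)) :
    Measurable (stoppedValue u σ) := by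
  have : Measurable fun p : ℕ × Ω => u p.1 p.2 := measurable_from_prod_countable_right hu
  exact this.comp ((measurable_untopA_of_isStoppingTime hσ).prodMk measurable_id)

variable {μ : Measure Ω} [IsProbabilityMeasure μ] {F : Measure ℝ}

/-- Decomposition of the event `{M > x}` at a fixed time, on an event of the past. -/
theorem measureReal_inter_lt_walkSupReal_shift {ξ : ℕ → Ω → ℝ} (hξ : ∀ n, Measurable (ξ n))
    (hindep : iIndepFun ξ μ) (hlaw : ∀ n, μ.map (ξ n) = F) (k : ℕ) {A : Set Ω}
    (hA : MeasurableSet[walkFiltration ξ hξ k] A) (x : ℝ) :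
    μ.real (A ∩ {ω | x - walk ξ k ω < walkSupReal (shift ξ k) ω}) =
      ∫ ω in A, tail (μ.map (walkSupReal ξ)) (x - walk ξ k ω) ∂μ := by
  have hA' : MeasurableSet A := (walkFiltration ξ hξ).le k _ hA
  have hX : Measurable[walkFiltration ξ hξ k] fun ω => (walk ξ k ω, ω ∈ A) := by
    have hw : Measurable[walkFiltration ξ hξ k] (walk ξ k) :=
      (comap_measurable (walk ξ k)).mono (le_iSup₂_of_le k le_rfl le_rfl) le_rfl
    exact measurable_prodMk_mem hw hA
  have hind := indepFun_of_measurable_past_future hξ hindep k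
    (hX.mono (walkFiltration_le hξ k) le_rfl) (measurable_walkSupReal (measurable_shift k))
  have hs : MeasurableSet {q : (ℝ × Prop) × ℝ | q.1.2 ∧ x - q.1.1 < q.2} := by
    refine MeasurableSet.inter (s₁ := {q : (ℝ × Prop) × ℝ | q.1.2})
      (s₂ := {q : (ℝ × Prop) × ℝ | x - q.1.1 < q.2}) ?_
      (measurableSet_lt (by fun_prop) (by fun_prop))
    exact measurableSet_setOfPred.2 (measurable_snd.comp measurable_fst)
  have h := measureReal_indepFun_eq_integral (hX.mono ((walkFiltration ξ hξ).le k) le_rfl)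
    (measurable_walkSupReal (ξ := shift ξ k) fun i => hξ (k + i)) hind hs
  refine h.trans ?_
  rw [← integral_indicator hA', map_walkSupReal_shift hξ hindep hlaw]
  congr 1 with ω
  by_cases hω : ω ∈ A
  · simp [hω, tail, Set.Ioi]
  · simp [hω]

/-- Almost surely `M_σ > x` implies `M > x`, so P(M > x, M_σ ≤ x) is what has to be subtracted. It
is computed by slicing over the values of σ. -/
theorem measureReal_lt_walkMax_stopped {ξ : ℕ → Ω → ℝ} (hξ : ∀ n, Measurable (ξ n))
    (hindep : iIndepFun ξ μ) (hlaw : ∀ n, μ.map (ξ n) = F)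
    (hbdd : ∀ᵐ ω ∂μ, BddAbove (Set.range fun n => walk ξ n ω))
    {σ : Ω → WithTop ℕ} (hσ : IsStoppingTime (walkFiltration ξ hξ) σ)
    (hσfin : ∀ᵐ ω ∂μ, σ ω < ⊤) (x : ℝ) :
    μ.real {ω | x < stoppedValue (walkMax ξ) σ ω} =
      tail (μ.map (walkSupReal ξ)) x -
        ∫ ω in {ω | stoppedValue (walkMax ξ) σ ω ≤ x},
          tail (μ.map (walkSupReal ξ)) (x - stoppedValue (walk ξ) σ ω) ∂μ := by
  set G := μ.map (walkSupReal ξ)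
  have : IsProbabilityMeasure G :=
    Measure.isProbabilityMeasure_map (measurable_walkSupReal hξ).aemeasurable
  have hS := measurable_stoppedValue_of_measurable hσ (measurable_walk hξ)
  have hM := measurable_stoppedValue_of_measurable hσ (measurable_walkMax hξ)
  set B : Set Ω := {ω | stoppedValue (walkMax ξ) σ ω ≤ x}
  have hB : MeasurableSet B := measurableSet_le hM measurable_const
  set E : Set Ω := {ω | x < walkSupReal ξ ω}
  have hE : MeasurableSet E := measurableSet_lt measurable_const (measurable_walkSupReal hξ)
  -- Each slice lies in 𝓕_k, so the fixed-time decomposition applies to it; the slices cover `B` up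
  -- to a null set.
  set A : ℕ → Set Ω := fun k => {ω | σ ω = k} ∩ {ω | walkMax ξ k ω ≤ x}
  have hA : ∀ k, MeasurableSet[walkFiltration ξ hξ k] (A k) := fun k => by
    refine (hσ.measurableSet_eq k).inter ?_
    have hm : ∀ i ≤ k, Measurable[walkFiltration ξ hξ k] (walk ξ i) := fun i hi =>
      (comap_measurable (walk ξ i)).mono (le_iSup₂_of_le i hi le_rfl) le_rfl
    have : {ω | walkMax ξ k ω ≤ x} = ⋂ i ∈ Finset.range (k + 1), {ω | walk ξ i ω ≤ x} := by
      ext ω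
      simp [walkMax]
    rw [this]
    refine Finset.measurableSet_biInter _ fun i hi => ?_
    exact hm i (Nat.lt_succ_iff.1 (Finset.mem_range.1 hi)) measurableSet_Iic
  have hA' : ∀ k, MeasurableSet (A k) := fun k => (walkFiltration ξ hξ).le k _ (hA k)
  have hdisj : Pairwise (Function.onFun Disjoint A) := fun i j hij =>
    Set.disjoint_left.2 fun ω hi hj => hij (by
      have := hi.1.symm.trans hj.1
      exact_mod_cast this)
  have hU : (⋃ k, A k) =ᵐ[μ] B := by
    filter_upwards [hσfin] with ω hω
    refine propext ?_
    change ω ∈ (⋃ k, A k) ↔ stoppedValue (walkMax ξ) σ ω ≤ x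
    obtain ⟨n, hn⟩ := WithTop.ne_top_iff_exists.1 hω.ne
    simp [A, ← hn, stoppedValue, untopA_natCast]
  have hval : ∀ k, ∫ ω in A k, E.indicator (1 : Ω → ℝ) ω ∂μ =
      ∫ ω in A k, tail G (x - stoppedValue (walk ξ) σ ω) ∂μ := fun k => by
    have hcongr : ∫ ω in A k, tail G (x - stoppedValue (walk ξ) σ ω) ∂μ =
        ∫ ω in A k, tail G (x - walk ξ k ω) ∂μ :=
      setIntegral_congr_fun (hA' k) fun ω hω => by
        have h1 : σ ω = k := hω.1
        simp [stoppedValue, h1, untopA_natCast]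
    rw [hcongr, ← measureReal_inter_lt_walkSupReal_shift hξ hindep hlaw k (hA k) x, integral_indicator_one hE,
      measureReal_restrict_apply hE]
    refine measureReal_congr ?_
    filter_upwards [hbdd] with ω hω
    refine propext ?_
    change x < walkSupReal ξ ω ∧ ω ∈ A k ↔
      ω ∈ A k ∧ x - walk ξ k ω < walkSupReal (shift ξ k) ω
    rw [and_comm, lt_walkSupReal_iff_shift hω k]
    refine and_congr_right fun h => or_iff_right (not_lt.2 h.2)
  have h1 : ∫ ω in B, E.indicator (1 : Ω → ℝ) ω ∂μ =
      ∫ ω in B, tail G (x - stoppedValue (walk ξ) σ ω) ∂μ := by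
    rw [← setIntegral_congr_set hU, ← setIntegral_congr_set hU, integral_iUnion hA' hdisj,
      integral_iUnion hA' hdisj]
    · exact tsum_congr hval
    · exact integrable_tail_comp _ _ (by fun_prop)
    · exact ((integrable_const (1 : ℝ)).indicator hE)
  rw [integral_indicator_one hE, measureReal_restrict_apply hE] at h1
  rw [← h1, tail_map (measurable_walkSupReal hξ), ← measureReal_inter_add_sdiff hB (s := E),
    add_sub_cancel_left]
  refine measureReal_congr ?_
  filter_upwards [hbdd, hσfin] with ω hω hfin
  refine propext ?_
  change x < stoppedValue (walkMax ξ) σ ω ↔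
    x < walkSupReal ξ ω ∧ ¬ stoppedValue (walkMax ξ) σ ω ≤ x
  rw [not_le, iff_and_self]
  exact fun h => (lt_walkSupReal_iff_shift hω _).2 (Or.inl h)

end Stopping

end GammaWalk

end

/-! ### Passage to the limit. -/

theorem mainTheorem4 {Ω : Type*} [MeasurableSpace Ω] (μ : Measure Ω) [IsProbabilityMeasure μ]
    (F : Measure ℝ) [IsProbabilityMeasure F]
    (ξ : ℕ → Ω → ℝ) (hξ : ∀ n, Measurable (ξ n)) (hindep : iIndepFun ξ μ)
    (hlaw : ∀ n, μ.map (ξ n) = F)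
    (γ : ℝ) (hγ : 0 < γ) (hF : GammaWalk.ClassS F γ) (hF1 : GammaWalk.expMoment F γ < 1)
    (σ : Ω → WithTop ℕ) (hσ : IsStoppingTime (GammaWalk.walkFiltration ξ hξ) σ)
    (hσ1 : ∀ᵐ ω ∂μ, 1 ≤ σ ω) (hσfin : ∀ᵐ ω ∂μ, σ ω < ⊤)
    (hσneg : ∀ᵐ ω ∂μ, stoppedValue (GammaWalk.walk ξ) σ ω ≤ 0)
    (χ : Ω → ℝ) (hχ : ∀ ω, χ ω = -stoppedValue (GammaWalk.walk ξ) σ ω) :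
    GammaWalk.expMomentSup ξ μ γ < ∞ ∧
    Tendsto
      (fun x : ℝ => μ.real {ω | x < stoppedValue (GammaWalk.walkMax ξ) σ ω} / GammaWalk.tail F x)
      atTop
      (𝓝 ((1 - ∫ ω, Real.exp (-γ * χ ω) ∂μ) *
        ((GammaWalk.expMomentSup ξ μ γ).toReal / (1 - (GammaWalk.expMoment F γ).toReal)))) := by
  open GammaWalk in
  refine ⟨expMomentSup_lt_top hξ hindep hlaw hγ hF1, ?_⟩
  have hbdd := ae_bddAbove_walk hξ hindep hlaw hγ hF1
  obtain ⟨⟨K, hK⟩, hlim⟩ := exists_bound_and_tendsto_tail_walkSupReal hξ hindep hlaw hγ hF hF1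
  set C := (expMomentSup ξ μ γ).toReal / (1 - (expMoment F γ).toReal)
  set G := μ.map (walkSupReal ξ)
  have : IsProbabilityMeasure G :=
    Measure.isProbabilityMeasure_map (measurable_walkSupReal hξ).aemeasurable
  have hS := measurable_stoppedValue_of_measurable hσ (measurable_walk hξ)
  have hM := measurable_stoppedValue_of_measurable hσ (measurable_walkMax hξ)
  have hpos := hF.classL.tail_pos
  -- Factor the ratio through `tail F (x - s)`.
  have hpt : ∀ s, Tendsto (fun x => tail G (x - s) / tail F x) atTop
      (𝓝 (C * Real.exp (γ * s))) := fun s => by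
    refine ((hlim.comp (tendsto_atTop_add_const_right _ (-s) tendsto_id)).mul
      (hF.classL.tendsto_ratio s)).congr fun x => ?_
    have := (hpos (x - s)).ne'
    simp only [Function.comp, id, ← sub_eq_add_neg]
    field_simp
  have hmain : Tendsto (fun x => (∫ ω in {ω | stoppedValue (walkMax ξ) σ ω ≤ x},
      tail G (x - stoppedValue (walk ξ) σ ω) ∂μ) / tail F x) atTop
      (𝓝 (∫ ω, C * Real.exp (-γ * χ ω) ∂μ)) := by
    have hB : ∀ x, MeasurableSet {ω | stoppedValue (walkMax ξ) σ ω ≤ x} := fun x =>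
      measurableSet_le hM measurable_const
    simp_rw [← integral_div, ← integral_indicator (hB _)]
    refine tendsto_integral_filter_of_dominated_convergence (fun _ => K) ?_ ?_
      (integrable_const _) ?_
    · filter_upwards with x
      refine Measurable.aestronglyMeasurable (Measurable.indicator ?_ (hB x))
      exact ((measurable_tail G).comp (measurable_const.sub hS)).div_const _
    · filter_upwards with x
      filter_upwards [hσneg] with ω hω
      refine (norm_indicator_le_norm_self _ _).trans ?_
      rw [Real.norm_of_nonneg (div_nonneg (tail_nonneg _ _) (tail_nonneg _ _)),
        div_le_iff₀ (hpos x)]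
      -- Since S_σ ≤ 0, tail G (x - S_σ) ≤ tail G x ≤ K · tail F x.
      exact (antitone_tail G (by linarith)).trans (hK x)
    · filter_upwards with ω
      rw [hχ, neg_mul_neg]
      refine (hpt _).congr' ?_
      -- For fixed ω the constraint M_σ ≤ x disappears once x is large.
      filter_upwards [eventually_ge_atTop (stoppedValue (walkMax ξ) σ ω)] with x hx
      rw [Set.indicator_of_mem (by exact hx)]
  simp_rw [measureReal_lt_walkMax_stopped hξ hindep hlaw hbdd hσ hσfin, sub_div]
  convert hlim.sub hmain using 2
  rw [integral_const_mul]
  ring
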